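/- Let $\mathbb{F}_q$ be a finite field with $q \ge 11$ elements and $\operatorname{char}\mathbb{F}_q > 3$, and let $C \subset \mathbb{P}^2$ be the plane curve over $\mathbb{F}_q$ defined by $$G(x,y,z) := x^{q-1} + y^{q-1} + z^{q-1} - 3(x+y+z)^{q-1} = 0.$$ Then $G$ is homogeneous of degree $q-1$, and: 1. $C$ is geometrically irreducible, that is, $G$ is irreducible as a polynomial over $\overline{\mathbb{F}_q}$; 2. $C$ is tangent-filling over $\mathbb{F}_q$: every point $P \in \mathbb{P}^2(\mathbb{F}_q)$ lies on the tangent line $T_Q C$ to $C$ at some smooth $\mathbb{F}_q$-point $Q$ of $C$, where $T_Q C$ is the line $\frac{\partial G}{\partial x}(Q)\,x + \frac{\partial G}{\partial y}(Q)\,y + \frac{\partial G}{\partial z}(Q)\,z = 0$; 3. $[1:1:1]$ is a singular point of $C$, and it is the only singular point of $C$ over $\overline{\mathbb{F}_q}$. -/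

import Mathlib

open MvPolynomial
open scoped LinearAlgebra.Projectivization

/-- The projective plane over the field `K`. -/
abbrev ProjPlane (K : Type*) [Field K] : Type _ := ℙ K (Fin 3 → K)

namespace PlaneCurve

variable {K : Type*} [Field K]

/- A plane curve over `K` is given by a form `G` in three variables. The conditions below evaluate forms
at chosen representatives of points; the lemmas that end in `_mk` say that for homogeneous `G` any
other representative gives the same answer. -/

/-- The `K`-point `P` lies on the curve `G = 0`. -/
def IsOn (G : MvPolynomial (Fin 3) K) (P : ProjPlane K) : Prop :=
  eval P.rep G = 0

/-- `P` is a singular `K`-point of the curve `G = 0`: it lies on the curve, and all the partial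
derivatives of `G` vanish there. -/
def IsSingularAt (G : MvPolynomial (Fin 3) K) (P : ProjPlane K) : Prop :=
  IsOn G P ∧ ∀ i, eval P.rep (pderiv i G) = 0

/-- `P` is a smooth `K`-point of the curve `G = 0`: it lies on the curve and is not singular. -/
def IsSmoothAt (G : MvPolynomial (Fin 3) K) (P : ProjPlane K) : Prop :=
  IsOn G P ∧ ∃ i, eval P.rep (pderiv i G) ≠ 0

/-- The `K`-points of the tangent line `∑ i, (∂G/∂xᵢ)(Q) xᵢ = 0` to the curve `G = 0` at a smooth
point `Q`. -/
def tangentLine (G : MvPolynomial (Fin 3) K) (Q : ProjPlane K) : Set (ProjPlane K) :=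
  {P | ∑ i, eval Q.rep (pderiv i G) * P.rep i = 0}

/-- The curve `G = 0` is tangent-filling over `K`: every `K`-point of the plane lies on the tangent
line at some smooth `K`-point of the curve. -/
def IsTangentFilling (G : MvPolynomial (Fin 3) K) : Prop :=
  ∀ P : ProjPlane K, ∃ Q : ProjPlane K, IsSmoothAt G Q ∧ P ∈ tangentLine G Q

/-- The base change of `G` to the algebraic closure of `K`. -/
noncomputable def geometric (G : MvPolynomial (Fin 3) K) :
    MvPolynomial (Fin 3) (AlgebraicClosure K) :=
  map (algebraMap K (AlgebraicClosure K)) G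

/-- The curve `G = 0` is geometrically irreducible: `G` is irreducible over the algebraic closure
of `K`. -/
def IsGeometricallyIrreducible (G : MvPolynomial (Fin 3) K) : Prop :=
  Irreducible (geometric G)

/-- The singular points of the curve `G = 0` over the algebraic closure of `K`. -/
def singularLocus (G : MvPolynomial (Fin 3) K) : Set (ProjPlane (AlgebraicClosure K)) :=
  {P | IsSingularAt (geometric G) P}

/-- The form `x^(q-1) + y^(q-1) + z^(q-1) - 3 (x+y+z)^(q-1)`. -/
noncomputable def specialForm (K : Type*) [Field K] (q : ℕ) : MvPolynomial (Fin 3) K :=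
  X 0 ^ (q - 1) + X 1 ^ (q - 1) + X 2 ^ (q - 1) - 3 * (X 0 + X 1 + X 2) ^ (q - 1)

/-- The point `[1:1:1]`. -/
def pointOne (K : Type*) [Field K] : ProjPlane K :=
  Projectivization.mk K ![1, 1, 1] (by simp)

theorem eval_smul_of_isHomogeneous {G : MvPolynomial (Fin 3) K} {d : ℕ} (hG : G.IsHomogeneous d)
    (a : K) (v : Fin 3 → K) : eval (a • v) G = a ^ d * eval v G := by
  rw [eval_eq, eval_eq, Finset.mul_sum]
  refine Finset.sum_congr rfl fun m hm => ?_
  have hd : ∑ i ∈ m.support, m i = d := by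
    have h := hG (mem_support_iff.mp hm)
    simpa [Finsupp.weight_apply, Finsupp.sum] using h
  simp only [Pi.smul_apply, smul_eq_mul, mul_pow, Finset.prod_mul_distrib]
  rw [Finset.prod_pow_eq_pow_sum, hd]
  ring

theorem eval_rep_mk_iff {G : MvPolynomial (Fin 3) K} {d : ℕ} (hG : G.IsHomogeneous d)
    (v : Fin 3 → K) (hv : v ≠ 0) :
    eval (Projectivization.mk K v hv).rep G = 0 ↔ eval v G = 0 := by
  obtain ⟨a, ha⟩ := Projectivization.exists_smul_eq_mk_rep K v hv
  rw [← ha, Units.smul_def, eval_smul_of_isHomogeneous hG]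
  simp

theorem isOn_mk {G : MvPolynomial (Fin 3) K} {d : ℕ} (hG : G.IsHomogeneous d)
    (v : Fin 3 → K) (hv : v ≠ 0) :
    IsOn G (Projectivization.mk K v hv) ↔ eval v G = 0 :=
  eval_rep_mk_iff hG v hv

theorem isSingularAt_mk {G : MvPolynomial (Fin 3) K} {d : ℕ} (hG : G.IsHomogeneous d)
    (v : Fin 3 → K) (hv : v ≠ 0) :
    IsSingularAt G (Projectivization.mk K v hv) ↔
      eval v G = 0 ∧ ∀ i, eval v (pderiv i G) = 0 := by
  simp only [IsSingularAt, isOn_mk hG, eval_rep_mk_iff (hG.pderiv)]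

theorem isSmoothAt_mk {G : MvPolynomial (Fin 3) K} {d : ℕ} (hG : G.IsHomogeneous d)
    (v : Fin 3 → K) (hv : v ≠ 0) :
    IsSmoothAt G (Projectivization.mk K v hv) ↔
      eval v G = 0 ∧ ∃ i, eval v (pderiv i G) ≠ 0 := by
  simp only [IsSmoothAt, isOn_mk hG, ne_eq, eval_rep_mk_iff (hG.pderiv)]

theorem mk_mem_tangentLine_mk {G : MvPolynomial (Fin 3) K} {d : ℕ} (hG : G.IsHomogeneous d)
    (u v : Fin 3 → K) (hu : u ≠ 0) (hv : v ≠ 0) :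
    Projectivization.mk K u hu ∈ tangentLine G (Projectivization.mk K v hv) ↔
      ∑ i, eval v (pderiv i G) * u i = 0 := by
  obtain ⟨a, ha⟩ := Projectivization.exists_smul_eq_mk_rep K u hu
  obtain ⟨b, hb⟩ := Projectivization.exists_smul_eq_mk_rep K v hv
  have h : ∑ i, eval (b • v) (pderiv i G) * (a • u) i =
      ((b : K) ^ (d - 1) * a) * ∑ i, eval v (pderiv i G) * u i := by
    rw [Finset.mul_sum]
    refine Finset.sum_congr rfl fun i _ => ?_
    rw [Units.smul_def, Units.smul_def, eval_smul_of_isHomogeneous hG.pderiv, Pi.smul_apply,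
      smul_eq_mul]
    ring
  rw [tangentLine, Set.mem_ofPred_eq, ← ha, ← hb, h]
  simp

end PlaneCurve

/-!
Write `q` for the number of elements of the base field, `s = x + y + z`, and `G` for the special
form. Since `q = 0` in the field, `∂G/∂x = 3 s^(q-2) - x^(q-2)`, and similarly for `y` and `z`.

*Singular points.* At a singular point all of `x^(q-2)`, `y^(q-2)`, `z^(q-2)` equal the same
constant `c = 3 s^(q-2) ≠ 0`, so `x^q = c x²`, `y^q = c y²`, `z^q = c z²` and `3 s^q = c s²`.
Additivity of Frobenius turns the last of these into `3 (x² + y² + z²) = s²`, which is a quadratic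
relation `a² - a b + b² = 0` between `a = x - z` and `b = y - z`. Applying Frobenius once more to
that relation leaves only `a = b = 0` (`eq_of_pow_eq_three_mul_pow`).

*Tangent lines.* The rational points are the `[x:y:z]` with `x y z s ≠ 0`, and the tangent line
there passes through `[a:b:c]` iff `(a/x + b/y + c/z) s = 3 (a + b + c)`. For general `[a:b:c]` the
point `[2a : b+c : b+c]`, which is on the line joining `[1:1:1]` to a vertex of the coordinate
triangle, is a solution. The exceptional `[a:b:c]` are those with `a + b + c = 0`, the vertices, and
`[1:1:1]`. In the first and the last case the solutions form a rational curve, and a field with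
enough elements has a parameter that avoids the excluded points (`hasTangentThrough_of_ne_zero`).

*Irreducibility.* The point `[1:1:1]` is an ordinary node. Two components would meet in as many
points as the product of their degrees, but they can only meet at the node, and with multiplicity
one. The required case of Bezout's theorem is `exists_common_zero_off_one_or_tangent`: restrict both
components to the pencil of lines through `[1:1:1]`, divide by the common zero there, and take the
resultant along each line. This is a binary form of positive degree in the direction of the line,
hence has a zero (`exists_eval_eq_zero_of_binary`), and a zero is either a further intersection point
or a common tangent direction at the node.
-/

/-! ### Resultants and binary forms -/

/-- The `(m, n)`-resultant is homogeneous of degree `m * n` under scaling of the variable: passing to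
`f(tX)` and `g(tX)` multiplies row `i` of the Sylvester matrix by `t ^ i` and divides column `j` of
each of its two blocks by `t ^ j`. -/
theorem Polynomial.resultant_comp_C_mul_X {K : Type*} [Field K] (f g : Polynomial K) (m n : ℕ)
    {t : K} (ht : t ≠ 0) :
    Polynomial.resultant (f.comp (Polynomial.C t * Polynomial.X))
      (g.comp (Polynomial.C t * Polynomial.X)) m n = t ^ (m * n) * Polynomial.resultant f g m n := by
  have key : Polynomial.sylvester (f.comp (Polynomial.C t * Polynomial.X))
      (g.comp (Polynomial.C t * Polynomial.X)) m n *
        Matrix.diagonal (Fin.addCases (fun j : Fin m => t ^ (j : ℕ)) fun j : Fin n => t ^ (j : ℕ)) =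
      Matrix.diagonal (fun i : Fin (m + n) => t ^ (i : ℕ)) * Polynomial.sylvester f g m n := by
    ext i j
    rw [Matrix.mul_diagonal, Matrix.diagonal_mul]
    induction j using Fin.addCases with
    | left j =>
      simp only [Polynomial.sylvester, Matrix.of_apply, Fin.addCases_left,
        Polynomial.comp_C_mul_X_coeff]
      split_ifs with h
      · rw [mul_assoc, ← pow_add, Nat.sub_add_cancel h.1, mul_comm]
      · simp
    | right j =>
      simp only [Polynomial.sylvester, Matrix.of_apply, Fin.addCases_right,
        Polynomial.comp_C_mul_X_coeff]
      split_ifs with h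
      · rw [mul_assoc, ← pow_add, Nat.sub_add_cancel h.1, mul_comm]
      · simp
  have hdet := congrArg Matrix.det key
  rw [Matrix.det_mul, Matrix.det_mul, Matrix.det_diagonal, Matrix.det_diagonal,
    Fin.prod_univ_add, Fin.prod_univ_add] at hdet
  simp only [Fin.addCases_left, Fin.addCases_right, Fin.val_castAdd, Fin.val_natAdd, pow_add,
    Finset.prod_mul_distrib, Finset.prod_const, Finset.card_univ, Fintype.card_fin, ← pow_mul]
    at hdet
  have hne (k : ℕ) : ∏ j : Fin k, t ^ (j : ℕ) ≠ 0 :=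
    Finset.prod_ne_zero_iff.mpr fun _ _ => pow_ne_zero _ ht
  apply mul_right_cancel₀ (mul_ne_zero (hne m) (hne n))
  rw [Polynomial.resultant, hdet, Polynomial.resultant]
  ring

/-- When the formal degrees `m` and `n` bound the degrees, a vanishing resultant means a common root on
the projective line; the second alternative is a common root at infinity. -/
theorem Polynomial.resultant_eq_zero_imp {K : Type*} [Field K] [IsAlgClosed K]
    {f g : Polynomial K} {m n : ℕ} (hf : f.natDegree ≤ m) (hg : g.natDegree ≤ n)
    (h : Polynomial.resultant f g m n = 0) :
    (∃ s, f.eval s = 0 ∧ g.eval s = 0) ∨ (f.coeff m = 0 ∧ g.coeff n = 0) := by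
  have main : ∀ {f g : Polynomial K} {m n : ℕ}, f.natDegree ≤ m → g.natDegree ≤ n →
      Polynomial.resultant f g m n = 0 → f.coeff m ≠ 0 → ∃ s, f.eval s = 0 ∧ g.eval s = 0 := by
    intro f g m n hf hg h hm
    obtain rfl : f.natDegree = m := le_antisymm hf (Polynomial.le_natDegree_of_ne_zero hm)
    rw [Polynomial.resultant_eq_prod_eval f g n hg (IsAlgClosed.splits f)] at h
    rcases mul_eq_zero.mp h with h | h
    · exact absurd (eq_zero_of_pow_eq_zero h) (by simpa using hm)
    · obtain ⟨s, hs, hs'⟩ := Multiset.mem_map.mp (Multiset.prod_eq_zero_iff.mp h)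
      exact ⟨s, (Polynomial.mem_roots'.mp hs).2, hs'⟩
  by_cases hm : f.coeff m = 0
  · by_cases hn : g.coeff n = 0
    · exact Or.inr ⟨hm, hn⟩
    · rw [Polynomial.resultant_comm, mul_eq_zero] at h
      obtain ⟨s, h1, h2⟩ := main hg hf (h.resolve_left (by simp)) hn
      exact Or.inl ⟨s, h2, h1⟩
  · exact Or.inl (main hf hg h hm)

namespace MvPolynomial

/-- A binary form of positive degree has a nontrivial zero over an algebraically closed field.
Homogeneity is expressed by the values only. -/
theorem exists_eval_eq_zero_of_binary {K : Type*} [Field K] [IsAlgClosed K]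
    (R : MvPolynomial (Fin 2) K) {N : ℕ} (hN : 0 < N)
    (hR : ∀ (t : K) (w : Fin 2 → K), t ≠ 0 → eval (t • w) R = t ^ N * eval w R) :
    ∃ w : Fin 2 → K, w ≠ 0 ∧ eval w R = 0 := by
  have eval_line (a b : Polynomial K) (t : K) :
      (aeval ![a, b] R).eval t = eval ![a.eval t, b.eval t] R := by
    simp only [← Polynomial.coe_aeval_eq_eval]
    rw [comp_aeval_apply,
      ← aeval_eq_eval]
    congr 2
    ext i; fin_cases i <;> rfl
  set r : Polynomial K := aeval ![Polynomial.X, 1] R with hr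
  by_cases hdeg : r.degree = 0
  -- If `R(t, 1)` is a nonzero constant `c`, then `R(1, t) = c t ^ N`, which vanishes at `t = 0`.
  · rw [Polynomial.eq_C_of_degree_eq_zero hdeg] at hr
    set c := r.coeff 0
    have h1 (t : K) : eval ![t, 1] R = c := by
      simpa [← hr] using (eval_line Polynomial.X 1 t).symm
    refine ⟨![1, 0], fun h => by simpa using congrFun h 0, ?_⟩
    -- The factor `X` spares a separate treatment of `t = 0`, where homogeneity says nothing.
    have h2 : Polynomial.X * aeval ![(1 : Polynomial K), Polynomial.X] R =
        Polynomial.C c * Polynomial.X ^ (N + 1) := by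
      refine Polynomial.funext fun t => ?_
      rcases eq_or_ne t 0 with rfl | ht
      · simp
      · have h3 := hR t ![t⁻¹, 1] ht
        rw [h1] at h3
        simp only [Polynomial.eval_mul, Polynomial.eval_X, eval_line, Polynomial.eval_one,
          Polynomial.eval_C, Polynomial.eval_pow]
        have h4 : t • ![t⁻¹, 1] = ![1, t] := by
          ext i; fin_cases i <;> simp [ht]
        rw [← h4, h3]; ring
    rw [pow_succ', mul_left_comm] at h2
    have h5 := congrArg (Polynomial.eval 0) (mul_left_cancel₀ Polynomial.X_ne_zero h2)
    rw [eval_line] at h5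
    simpa [hN.ne'] using h5
  · obtain ⟨t, ht⟩ := IsAlgClosed.exists_root r hdeg
    refine ⟨![t, 1], fun h => by simpa using congrFun h 1, ?_⟩
    simpa [hr, eval_line, Polynomial.IsRoot] using ht

/-- Let the coefficients of `X ^ k` in `f` and `g` be binary forms of degree `k + e`. Then, for some
direction `w`, the polynomials `f` and `g` specialised at `w` have a common zero on the projective
line, as their resultant is a binary form of degree `e * n + e * m + m * n`. -/
theorem exists_common_zero_of_binary_coeffs {K : Type*} [Field K] [IsAlgClosed K]
    (f g : Polynomial (MvPolynomial (Fin 2) K)) {m n e : ℕ}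
    (hf : f.natDegree ≤ m) (hg : g.natDegree ≤ n) (hN : 0 < e * n + e * m + m * n)
    (hft : ∀ (t : K) (w : Fin 2 → K), t ≠ 0 → f.map (eval (t • w)) =
      Polynomial.C (t ^ e) * (f.map (eval w)).comp (Polynomial.C t * Polynomial.X))
    (hgt : ∀ (t : K) (w : Fin 2 → K), t ≠ 0 → g.map (eval (t • w)) =
      Polynomial.C (t ^ e) * (g.map (eval w)).comp (Polynomial.C t * Polynomial.X)) :
    ∃ w : Fin 2 → K, w ≠ 0 ∧
      ((∃ s, (f.map (eval w)).eval s = 0 ∧ (g.map (eval w)).eval s = 0) ∨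
        (eval w (f.coeff m) = 0 ∧ eval w (g.coeff n) = 0)) := by
  obtain ⟨w, hw, h⟩ := exists_eval_eq_zero_of_binary (Polynomial.resultant f g m n) hN
    fun t w ht => by
      rw [← Polynomial.resultant_map_map, ← Polynomial.resultant_map_map, hft t w ht, hgt t w ht,
        Polynomial.resultant_C_mul_left, Polynomial.resultant_C_mul_right,
        Polynomial.resultant_comp_C_mul_X _ _ _ _ ht]
      ring
  rw [← Polynomial.resultant_map_map] at h
  have := Polynomial.resultant_eq_zero_imp (Polynomial.natDegree_map_le.trans hf)
    (Polynomial.natDegree_map_le.trans hg) h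
  exact ⟨w, hw, by simpa only [Polynomial.coeff_map, RingHom.coe_coe] using this⟩

/-! ### Homogeneous polynomials: factors and substitutions -/

section Homogeneous

variable {σ R : Type*} [CommRing R]

/-- Substituting `T * X i` for `X i` multiplies a form of degree `m` by `T ^ m`. -/
theorem aeval_C_X_mul_X_of_isHomogeneous {A : MvPolynomial σ R} {m : ℕ} (hA : A.IsHomogeneous m) :
    aeval (fun i => Polynomial.C (X i : MvPolynomial σ R) * Polynomial.X) A =
      Polynomial.C A * Polynomial.X ^ m := by
  conv_rhs => rw [A.as_sum]
  conv_lhs => rw [A.as_sum]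
  rw [map_sum, map_sum, Finset.sum_mul]
  refine Finset.sum_congr rfl fun d hd => ?_
  have hdeg : d.sum (fun _ k => k) = m := by
    rw [Finsupp.sum, hA.degree_eq_sum_deg_support hd]
  rw [aeval_monomial, monomial_eq, ← hdeg]
  simp only [mul_pow, Finsupp.prod, Finset.prod_mul_distrib, Finset.prod_pow_eq_pow_sum,
    Finsupp.sum, map_mul, map_prod, map_pow, mul_assoc]
  rfl

/-- A factor of a nonzero form over a domain is a form: after the substitution of `T * X i` for `X i`
the product is a monomial in `T`, and the degree and the trailing degree in `T` are both additive. -/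
theorem isHomogeneous_left_of_mul [IsDomain R] {A B : MvPolynomial σ R} {d : ℕ}
    (h : (A * B).IsHomogeneous d) (h0 : A * B ≠ 0) : ∃ m, A.IsHomogeneous m := by
  let φ : MvPolynomial σ R →ₐ[R] Polynomial (MvPolynomial σ R) :=
    aeval fun i => Polynomial.C (X i : MvPolynomial σ R) * Polynomial.X
  have hφ : φ A = ∑ k ∈ Finset.range (A.totalDegree + 1),
      Polynomial.C (homogeneousComponent k A) * Polynomial.X ^ k := by
    conv_lhs => rw [← sum_homogeneousComponent A, map_sum]
    exact Finset.sum_congr rfl fun k _ =>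
      aeval_C_X_mul_X_of_isHomogeneous (homogeneousComponent_isHomogeneous k A)
  have hcoeff (k : ℕ) : (φ A).coeff k = homogeneousComponent k A := by
    rw [hφ]
    simp only [Polynomial.finsetSum_coeff, Polynomial.coeff_C_mul_X_pow]
    rw [Finset.sum_ite_eq]
    split_ifs with hk
    · rfl
    · exact (homogeneousComponent_eq_zero _ _ (by simpa using hk)).symm
  have hAB : φ A * φ B = Polynomial.C (A * B) * Polynomial.X ^ d := by
    rw [← map_mul]; exact aeval_C_X_mul_X_of_isHomogeneous h
  have hne : φ A * φ B ≠ 0 := by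
    rw [hAB]; exact mul_ne_zero (by simpa using h0) (pow_ne_zero _ Polynomial.X_ne_zero)
  have hA := left_ne_zero_of_mul hne
  have hB := right_ne_zero_of_mul hne
  have h1 := congrArg Polynomial.natDegree hAB
  have h2 := congrArg Polynomial.natTrailingDegree hAB
  rw [Polynomial.natDegree_mul hA hB, Polynomial.natDegree_C_mul_X_pow _ _ h0] at h1
  rw [Polynomial.natTrailingDegree_mul hA hB, Polynomial.natTrailingDegree_mul_X_pow (by simpa using h0),
    Polynomial.natTrailingDegree_C, zero_add] at h2
  have h3 := Polynomial.natTrailingDegree_le_natDegree (φ A)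
  have h4 := Polynomial.natTrailingDegree_le_natDegree (φ B)
  refine ⟨(φ A).natDegree, ?_⟩
  have hcomp (k : ℕ) (hk : k ≠ (φ A).natDegree) : homogeneousComponent k A = 0 := by
    rw [← hcoeff]
    rcases lt_or_gt_of_ne hk with hk | hk
    · exact Polynomial.coeff_eq_zero_of_lt_natTrailingDegree (by omega)
    · exact Polynomial.coeff_eq_zero_of_natDegree_lt hk
  generalize (φ A).natDegree = m at hcomp
  rw [← sum_homogeneousComponent A]
  refine IsHomogeneous.sum _ _ _ fun k _ => ?_
  by_cases hk : k = m
  · rw [← hk]; exact homogeneousComponent_isHomogeneous k A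
  · rw [hcomp k hk]; exact isHomogeneous_zero _ _ _

/-- Restricting a form of degree `m` to a parametrised line `l` gives a polynomial of degree at most
`m`, whose coefficient in degree `m` is the value of the form at the point at infinity of the line. -/
theorem natDegree_aeval_le_and_coeff_of_isHomogeneous {K : Type*} [CommRing K] [Algebra K R]
    {A : MvPolynomial σ K} {m : ℕ} (hA : A.IsHomogeneous m) (l : σ → Polynomial R)
    (hl : ∀ i, (l i).natDegree ≤ 1) :
    (aeval l A).natDegree ≤ m ∧
      (aeval l A).coeff m = aeval (fun i => (l i).coeff 1) A := by
  have key : ∀ d ∈ A.support, (aeval l (monomial d (A.coeff d))).natDegree ≤ m ∧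
      (aeval l (monomial d (A.coeff d))).coeff m =
        aeval (fun i => (l i).coeff 1) (monomial d (A.coeff d)) := by
    intro d hd
    have hdeg : ∑ i ∈ d.support, d i = m := by
      rw [← hA.degree_eq_sum_deg_support hd]
    have hpow (i : σ) : (l i ^ d i).natDegree ≤ d i := by
      simpa using Polynomial.natDegree_pow_le_of_le (d i) (hl i)
    have hprod : ∀ s : Finset σ, (∏ i ∈ s, l i ^ d i).natDegree ≤ ∑ i ∈ s, d i ∧
        (∏ i ∈ s, l i ^ d i).coeff (∑ i ∈ s, d i) = ∏ i ∈ s, (l i).coeff 1 ^ d i := by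
      classical
      intro s
      induction s using Finset.induction_on with
      | empty => simp
      | insert a s ha ih =>
        rw [Finset.prod_insert ha, Finset.sum_insert ha, Finset.prod_insert ha]
        refine ⟨Polynomial.natDegree_mul_le_of_le (hpow a) ih.1, ?_⟩
        rw [Polynomial.coeff_mul_add_eq_of_natDegree_le (hpow a) ih.1, ih.2]
        congr 1
        simpa using Polynomial.coeff_pow_of_natDegree_le (m := d a) (hl a)
    rw [aeval_monomial, aeval_monomial, Finsupp.prod, Finsupp.prod, Polynomial.algebraMap_apply,
      ← hdeg]
    refine ⟨(Polynomial.natDegree_C_mul_le _ _).trans (hprod _).1, ?_⟩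
    rw [Polynomial.coeff_C_mul, (hprod _).2]
  have hsum {S : Type _} [CommRing S] [Algebra K S] (l : σ → S) : aeval l A =
      ∑ d ∈ A.support, aeval l (monomial d (A.coeff d)) := by
    conv_lhs => rw [A.as_sum, map_sum]
  rw [hsum, hsum]
  refine ⟨Polynomial.natDegree_sum_le_of_forall_le _ _ fun d hd => (key d hd).1, ?_⟩
  rw [Polynomial.finsetSum_coeff]
  exact Finset.sum_congr rfl fun d hd => (key d hd).2

end Homogeneous

/-- The chain rule. -/
theorem derivative_aeval {σ R : Type*} [Fintype σ] [CommRing R]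
    (l : σ → Polynomial R) (A : MvPolynomial σ R) :
    Polynomial.derivative (aeval l A) =
      ∑ i, aeval l (pderiv i A) * Polynomial.derivative (l i) := by
  classical
  induction A using MvPolynomial.induction_on with
  | C a => simp
  | add p q hp hq => simp [hp, hq, add_mul, Finset.sum_add_distrib]
  | mul_X p i hp =>
    have h (j : σ) : aeval l (pderiv j (p * X i)) * Polynomial.derivative (l j) =
        (if j = i then aeval l p * Polynomial.derivative (l i) else 0) +
          l i * (aeval l (pderiv j p) * Polynomial.derivative (l j)) := by
      rw [Derivation.leibniz, pderiv_X, Pi.single_apply]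
      by_cases hj : j = i
      · subst hj; simp [add_mul, mul_assoc]
      · simp [hj, Ne.symm hj, mul_assoc]
    rw [map_mul, aeval_X, Polynomial.derivative_mul, hp, Finset.sum_congr rfl fun j _ => h j,
      Finset.sum_add_distrib, Finset.sum_ite_eq', if_pos (Finset.mem_univ _), ← Finset.mul_sum]
    ring

end MvPolynomial

/-! ### Bezout's theorem in the pencil of lines through `[1:1:1]` -/

namespace PlaneCurve

/-- The line `S ↦ (1 + w₀ S, 1 + w₁ S, 1)` through `(1, 1, 1)` with direction `(w₀, w₁, 0)`. -/
noncomputable def lineThroughOne {R : Type*} [CommRing R] (w : Fin 2 → R) : Fin 3 → Polynomial R :=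
  ![1 + Polynomial.C (w 0) * Polynomial.X, 1 + Polynomial.C (w 1) * Polynomial.X, 1]

/-- The restriction of `A` to the generic line through `(1, 1, 1)`: the coefficients are polynomials in
the direction of the line. -/
noncomputable def restrictPencil {K : Type*} [CommRing K] (A : MvPolynomial (Fin 3) K) :
    Polynomial (MvPolynomial (Fin 2) K) :=
  aeval (lineThroughOne X) A

section Pencil

variable {K : Type*} [Field K] (A : MvPolynomial (Fin 3) K)

theorem map_restrictPencil (w : Fin 2 → K) :
    (restrictPencil A).map (eval w) = aeval (lineThroughOne w) A := by
  have h := comp_aeval_apply (R := K) (lineThroughOne (X : Fin 2 → MvPolynomial (Fin 2) K))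
    (Polynomial.mapAlgHom (aeval w)) A
  simp only [Polynomial.coe_mapAlgHom] at h
  have h' : ((aeval w : MvPolynomial (Fin 2) K →ₐ[K] K) : MvPolynomial (Fin 2) K →+* K) = eval w := by
    ext <;> simp
  rw [restrictPencil, ← h', h]
  congr 2
  ext i : 1
  fin_cases i <;> simp [lineThroughOne]

theorem eval_aeval_lineThroughOne (w : Fin 2 → K) (s : K) :
    (aeval (lineThroughOne w) A).eval s = eval ![1 + w 0 * s, 1 + w 1 * s, 1] A := by
  simp only [← Polynomial.coe_aeval_eq_eval]
  rw [comp_aeval_apply, ← aeval_eq_eval]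
  congr 2
  ext i
  fin_cases i <;> simp [lineThroughOne]

theorem aeval_lineThroughOne_smul (t : K) (w : Fin 2 → K) :
    aeval (lineThroughOne (t • w)) A =
      (aeval (lineThroughOne w) A).comp (Polynomial.C t * Polynomial.X) := by
  have h := comp_aeval_apply (R := K) (lineThroughOne w)
    (Polynomial.aeval (Polynomial.C t * Polynomial.X)) A
  rw [Polynomial.comp_eq_aeval, h]
  congr 2
  ext i : 1
  fin_cases i <;> simp [lineThroughOne] <;> ring

theorem eval_coeff_zero_restrictPencil (w : Fin 2 → K) :
    eval w ((restrictPencil A).coeff 0) = eval ![1, 1, 1] A := by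
  rw [← Polynomial.coeff_map, map_restrictPencil, Polynomial.coeff_zero_eq_eval_zero,
    eval_aeval_lineThroughOne]
  simp

theorem eval_coeff_one_restrictPencil (w : Fin 2 → K) :
    eval w ((restrictPencil A).coeff 1) =
      w 0 * eval ![1, 1, 1] (pderiv 0 A) + w 1 * eval ![1, 1, 1] (pderiv 1 A) := by
  have h := congrArg (Polynomial.eval 0) (derivative_aeval (lineThroughOne w) A)
  rw [← map_restrictPencil, ← Polynomial.coeff_zero_eq_eval_zero, Polynomial.coeff_derivative,
    Polynomial.coeff_map] at h
  simp only [Fin.sum_univ_three, Polynomial.eval_add, Polynomial.eval_mul,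
    eval_aeval_lineThroughOne] at h
  have d0 : Polynomial.derivative (lineThroughOne w 0) = Polynomial.C (w 0) := by
    simp [lineThroughOne]
  have d1 : Polynomial.derivative (lineThroughOne w 1) = Polynomial.C (w 1) := by
    simp [lineThroughOne]
  have d2 : Polynomial.derivative (lineThroughOne w 2) = 0 := by
    simp [lineThroughOne]
  rw [d0, d1, d2] at h
  simp only [mul_zero, add_zero, Polynomial.eval_C, Polynomial.eval_zero, Nat.cast_zero, zero_add,
    mul_one] at h
  rw [h]
  ring

variable {A}

theorem natDegree_lineThroughOne_le {R : Type*} [CommRing R] (w : Fin 2 → R) (i : Fin 3) :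
    (lineThroughOne w i).natDegree ≤ 1 := by
  have h (a : R) : (1 + Polynomial.C a * Polynomial.X).natDegree ≤ 1 := by compute_degree
  fin_cases i
  · exact h _
  · exact h _
  · exact (Polynomial.natDegree_one (R := R)).le.trans zero_le_one

theorem natDegree_restrictPencil_le {m : ℕ} (hA : A.IsHomogeneous m) :
    (restrictPencil A).natDegree ≤ m :=
  (natDegree_aeval_le_and_coeff_of_isHomogeneous hA _ (natDegree_lineThroughOne_le _)).1

theorem eval_coeff_restrictPencil {m : ℕ} (hA : A.IsHomogeneous m) (w : Fin 2 → K) :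
    eval w ((restrictPencil A).coeff m) = eval ![w 0, w 1, 0] A := by
  rw [← Polynomial.coeff_map, map_restrictPencil,
    (natDegree_aeval_le_and_coeff_of_isHomogeneous hA _ (natDegree_lineThroughOne_le _)).2,
    ← aeval_eq_eval]
  congr 2
  ext i
  fin_cases i <;> simp [lineThroughOne, Polynomial.coeff_one]

theorem ne_zero_and_ne_one_of_pencil {w : Fin 2 → K} (hw : w ≠ 0) {s : K} (hs : s ≠ 0) :
    (![1 + w 0 * s, 1 + w 1 * s, 1] : Fin 3 → K) ≠ 0 ∧
      ¬(1 + w 0 * s = 1 ∧ 1 + w 1 * s = 1) := by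
  refine ⟨fun h => by simpa using congrFun h 2, fun h => hw ?_⟩
  ext i
  fin_cases i
  · simpa [hs] using h.1
  · simpa [hs] using h.2

/-- Two plane curves of positive degrees `m` and `n`, with `m + n ≥ 3`, either have a common point
other than `[1:1:1]`, or both pass through `[1:1:1]` and have a common tangent direction there.
This is Bezout's theorem in the form that the intersection number `m * n` exceeds `1`. -/
theorem exists_common_zero_off_one_or_tangent [IsAlgClosed K] {A B : MvPolynomial (Fin 3) K}
    {m n : ℕ} (hA : A.IsHomogeneous m) (hB : B.IsHomogeneous n) (hm : 0 < m) (hn : 0 < n)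
    (hmn : 3 ≤ m + n) :
    (∃ v : Fin 3 → K, v ≠ 0 ∧ ¬(v 0 = v 2 ∧ v 1 = v 2) ∧ eval v A = 0 ∧ eval v B = 0) ∨
    ∃ w : Fin 2 → K, w ≠ 0 ∧ eval ![1, 1, 1] A = 0 ∧ eval ![1, 1, 1] B = 0 ∧
      w 0 * eval ![1, 1, 1] (pderiv 0 A) + w 1 * eval ![1, 1, 1] (pderiv 1 A) = 0 ∧
      w 0 * eval ![1, 1, 1] (pderiv 0 B) + w 1 * eval ![1, 1, 1] (pderiv 1 B) = 0 := by
  -- A common zero on the line with direction `w`, at infinity and at a finite parameter `s ≠ 0`.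
  have infinity {w : Fin 2 → K} (hw : w ≠ 0) (hwA : eval ![w 0, w 1, 0] A = 0)
      (hwB : eval ![w 0, w 1, 0] B = 0) :
      ∃ v : Fin 3 → K, v ≠ 0 ∧ ¬(v 0 = v 2 ∧ v 1 = v 2) ∧ eval v A = 0 ∧ eval v B = 0 := by
    have hw' : ¬(w 0 = 0 ∧ w 1 = 0) := fun h => hw (by ext i; fin_cases i; exacts [h.1, h.2])
    refine ⟨![w 0, w 1, 0], fun h => hw' ⟨?_, ?_⟩, by simpa using hw', hwA, hwB⟩
    · simpa using congrFun h 0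
    · simpa using congrFun h 1
  have finite {w : Fin 2 → K} (hw : w ≠ 0) {s : K} (hs : s ≠ 0)
      (hwA : (aeval (lineThroughOne w) A).eval s = 0)
      (hwB : (aeval (lineThroughOne w) B).eval s = 0) :
      ∃ v : Fin 3 → K, v ≠ 0 ∧ ¬(v 0 = v 2 ∧ v 1 = v 2) ∧ eval v A = 0 ∧ eval v B = 0 := by
    rw [eval_aeval_lineThroughOne] at hwA hwB
    obtain ⟨h1, h2⟩ := ne_zero_and_ne_one_of_pencil hw hs
    exact ⟨_, h1, by simpa using h2, hwA, hwB⟩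
  -- If both curves pass through `[1:1:1]`, the restrictions to the lines of the pencil are divided by
  -- the parameter `S`. The coefficients in degree `k` then have weight `k + 1`, and the resultant has
  -- degree `m * n - 1`. Otherwise it is taken without division and has degree `m * n`.
  by_cases h1 : eval ![1, 1, 1] A = 0 ∧ eval ![1, 1, 1] B = 0
  · have hX {P : MvPolynomial (Fin 3) K} (hP : eval ![1, 1, 1] P = 0) :
        restrictPencil P = Polynomial.X * (restrictPencil P).divX := by
      have h0 : (restrictPencil P).coeff 0 = 0 :=
        MvPolynomial.funext fun w => by rw [eval_coeff_zero_restrictPencil, hP, map_zero]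
      conv_lhs => rw [← Polynomial.X_mul_divX_add (restrictPencil P), h0, map_zero, add_zero]
    have hXw {P : MvPolynomial (Fin 3) K} (hP : eval ![1, 1, 1] P = 0) (w : Fin 2 → K) :
        aeval (lineThroughOne w) P =
          Polynomial.X * (restrictPencil P).divX.map (eval w) := by
      rw [← map_restrictPencil]
      conv_lhs => rw [hX hP, Polynomial.map_mul, Polynomial.map_X]
    have hscale {P : MvPolynomial (Fin 3) K} (hP : eval ![1, 1, 1] P = 0) (t : K)
        (w : Fin 2 → K) : (restrictPencil P).divX.map (eval (t • w)) =
          Polynomial.C (t ^ 1) * ((restrictPencil P).divX.map (eval w)).comp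
            (Polynomial.C t * Polynomial.X) := by
      apply mul_left_cancel₀ (Polynomial.X_ne_zero (R := K))
      rw [← hXw hP, aeval_lineThroughOne_smul, hXw hP, Polynomial.mul_comp, Polynomial.X_comp,
        pow_one]
      ring
    have hdeg {P : MvPolynomial (Fin 3) K} {k : ℕ} (hP : P.IsHomogeneous k) :
        (restrictPencil P).divX.natDegree ≤ k - 1 := by
      rw [Polynomial.natDegree_divX_eq_natDegree_tsub_one]
      exact Nat.sub_le_sub_right (natDegree_restrictPencil_le hP) 1
    -- This number is `m * n - 1`.
    have hpos : 0 < 1 * (n - 1) + 1 * (m - 1) + (m - 1) * (n - 1) :=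
      Nat.lt_of_lt_of_le (by omega) (Nat.le_add_right _ _)
    obtain ⟨w, hw, ⟨s, hsA, hsB⟩ | ⟨hwA, hwB⟩⟩ :=
      exists_common_zero_of_binary_coeffs _ _ (hdeg hA) (hdeg hB) hpos
        (fun t w _ => hscale h1.1 t w) (fun t w _ => hscale h1.2 t w)
    · rcases eq_or_ne s 0 with rfl | hs
      · rw [← Polynomial.coeff_zero_eq_eval_zero, Polynomial.coeff_map, Polynomial.coeff_divX,
          eval_coeff_one_restrictPencil] at hsA hsB
        exact Or.inr ⟨w, hw, h1.1, h1.2, hsA, hsB⟩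
      · refine Or.inl (finite hw hs ?_ ?_)
        · rw [hXw h1.1, Polynomial.eval_mul, hsA, mul_zero]
        · rw [hXw h1.2, Polynomial.eval_mul, hsB, mul_zero]
    · rw [Polynomial.coeff_divX, Nat.sub_add_cancel hm, eval_coeff_restrictPencil hA] at hwA
      rw [Polynomial.coeff_divX, Nat.sub_add_cancel hn, eval_coeff_restrictPencil hB] at hwB
      exact Or.inl (infinity hw hwA hwB)
  · have hscale (P : MvPolynomial (Fin 3) K) (t : K) (w : Fin 2 → K) :
        (restrictPencil P).map (eval (t • w)) = Polynomial.C (t ^ 0) *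
          ((restrictPencil P).map (eval w)).comp (Polynomial.C t * Polynomial.X) := by
      rw [map_restrictPencil, map_restrictPencil, aeval_lineThroughOne_smul]
      simp
    have hpos : 0 < 0 * n + 0 * m + m * n := by simpa using ⟨hm, hn⟩
    obtain ⟨w, hw, ⟨s, hsA, hsB⟩ | ⟨hwA, hwB⟩⟩ :=
      exists_common_zero_of_binary_coeffs _ _ (natDegree_restrictPencil_le hA)
        (natDegree_restrictPencil_le hB) hpos (fun t w _ => hscale A t w) fun t w _ => hscale B t w
    · rw [map_restrictPencil] at hsA hsB
      refine Or.inl (finite hw (fun hs => h1 ?_) hsA hsB)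
      subst hs
      rw [eval_aeval_lineThroughOne] at hsA hsB
      simp only [mul_zero, add_zero] at hsA hsB
      exact ⟨hsA, hsB⟩
    · rw [eval_coeff_restrictPencil hA] at hwA
      rw [eval_coeff_restrictPencil hB] at hwB
      exact Or.inl (infinity hw hwA hwB)

end Pencil

/-- A plane curve of degree at least `3` with no singular point other than `[1:1:1]` is irreducible if
no direction in the chart `z = 1` at that point is in the kernel of the Hessian. If the two factors
of a product vanish at a point and have a common tangent direction there, that direction is in the
kernel of the Hessian of the product. -/
theorem irreducible_of_node_at_one {K : Type*} [Field K] [IsAlgClosed K]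
    {G : MvPolynomial (Fin 3) K} {d : ℕ} (hG : G.IsHomogeneous d) (hd : 3 ≤ d) (hG0 : G ≠ 0)
    (hsing : ∀ v : Fin 3 → K, v ≠ 0 → eval v G = 0 → (∀ i, eval v (pderiv i G) = 0) →
      v 0 = v 2 ∧ v 1 = v 2)
    (hnode : ∀ w : Fin 2 → K, (∀ j, w 0 * eval ![1, 1, 1] (pderiv 0 (pderiv j G)) +
      w 1 * eval ![1, 1, 1] (pderiv 1 (pderiv j G)) = 0) → w = 0) :
    Irreducible G := by
  have unit_of_zero {P : MvPolynomial (Fin 3) K} (hP : P.IsHomogeneous 0) (hP0 : P ≠ 0) :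
      IsUnit P := by
    have h := totalDegree_eq_zero_iff_eq_C.mp (Nat.le_zero.mp hP.totalDegree_le)
    rw [h]
    exact (IsUnit.mk0 _ fun h' => hP0 (by rw [h, h', C_0])).map C
  constructor
  · intro hu
    have h := hG.totalDegree hG0
    rw [(isUnit_iff_totalDegree_of_isReduced.mp hu).2] at h
    omega
  · rintro A B rfl
    obtain ⟨m, hA⟩ := isHomogeneous_left_of_mul hG hG0
    obtain ⟨n, hB⟩ := isHomogeneous_left_of_mul (mul_comm A B ▸ hG) (mul_comm A B ▸ hG0)
    have hmn : m + n = d := (hA.mul hB).inj_right hG hG0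
    rcases Nat.eq_zero_or_pos m with rfl | hm
    · exact Or.inl (unit_of_zero hA (left_ne_zero_of_mul hG0))
    rcases Nat.eq_zero_or_pos n with rfl | hn
    · exact Or.inr (unit_of_zero hB (right_ne_zero_of_mul hG0))
    exfalso
    rcases exists_common_zero_off_one_or_tangent hA hB hm hn (by omega) with
      ⟨v, hv, hv1, hvA, hvB⟩ | ⟨w, hw, h1A, h1B, hwA, hwB⟩
    · refine hv1 (hsing v hv (by simp [hvA]) fun i => ?_)
      simp [Derivation.leibniz, hvA, hvB]
    · refine hw (hnode w fun j => ?_)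
      simp only [Derivation.leibniz, smul_eq_mul, map_add, map_mul, h1A, h1B]
      linear_combination eval ![1, 1, 1] (pderiv j B) * hwA + eval ![1, 1, 1] (pderiv j A) * hwB

end PlaneCurve

/-! ### The special form and its derivatives -/

namespace PlaneCurve

theorem isHomogeneous_specialForm (K : Type*) [Field K] (q : ℕ) :
    (specialForm K q).IsHomogeneous (q - 1) := by
  have h3 : (3 : MvPolynomial (Fin 3) K) = C 3 := (map_ofNat C 3).symm
  rw [specialForm, h3]
  refine (((isHomogeneous_X_pow _ _).add (isHomogeneous_X_pow _ _)).add
    (isHomogeneous_X_pow _ _)).sub (IsHomogeneous.C_mul ?_ _)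
  simpa using ((((isHomogeneous_X K (0 : Fin 3)).add (isHomogeneous_X K 1)).add
    (isHomogeneous_X K 2)).pow (q - 1))

theorem eval_specialForm {K : Type*} [Field K] (q : ℕ) (v : Fin 3 → K) :
    eval v (specialForm K q) = v 0 ^ (q - 1) + v 1 ^ (q - 1) + v 2 ^ (q - 1) -
      3 * (v 0 + v 1 + v 2) ^ (q - 1) := by
  simp [specialForm]

theorem geometric_specialForm (K : Type*) [Field K] (q : ℕ) :
    geometric (specialForm K q) = specialForm (AlgebraicClosure K) q := by
  simp [geometric, specialForm]

theorem specialForm_ne_zero {K : Type*} [Field K] {q : ℕ} (hq : 2 ≤ q) (h2 : (2 : K) ≠ 0) :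
    specialForm K q ≠ 0 := by
  intro h
  have h' := congrArg (eval ![1, 0, 0]) h
  rw [eval_specialForm, map_zero] at h'
  have hq' : q - 1 ≠ 0 := by omega
  simp only [Matrix.cons_val, one_pow, zero_pow hq'] at h'
  exact h2 (by linear_combination -h')

theorem pderiv_specialForm {K : Type*} [Field K] {q : ℕ} (hq : 2 ≤ q) (hqK : (q : K) = 0)
    (i : Fin 3) : pderiv i (specialForm K q) =
      3 * (X 0 + X 1 + X 2) ^ (q - 2) - X i ^ (q - 2) := by
  -- The exponent `q - 1` becomes `-1` in `K`.
  have hc : ((q - 1 : ℕ) : MvPolynomial (Fin 3) K) = -1 := by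
    rw [Nat.cast_sub (by omega), ← map_natCast (C : K →+* _), hqK]; simp
  have hq' : q - 1 - 1 = q - 2 := by omega
  have h3 (k : Fin 3) : pderiv k (3 : MvPolynomial (Fin 3) K) = 0 := by
    rw [← map_ofNat C 3]; exact pderiv_C
  fin_cases i <;>
    simp [specialForm, Derivation.leibniz, pderiv_X, hc, hq', h3] <;> ring

theorem eval_pderiv_specialForm {K : Type*} [Field K] {q : ℕ} (hq : 2 ≤ q) (hqK : (q : K) = 0)
    (i : Fin 3) (v : Fin 3 → K) : eval v (pderiv i (specialForm K q)) =
      3 * (v 0 + v 1 + v 2) ^ (q - 2) - v i ^ (q - 2) := by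
  simp [pderiv_specialForm hq hqK]

theorem eval_pderiv_pderiv_specialForm {K : Type*} [Field K] {q : ℕ} (hq : 3 ≤ q)
    (hqK : (q : K) = 0) (i j : Fin 3) (v : Fin 3 → K) :
    eval v (pderiv i (pderiv j (specialForm K q))) =
      (if i = j then 2 * v j ^ (q - 3) else 0) - 6 * (v 0 + v 1 + v 2) ^ (q - 3) := by
  have hc : ((q - 2 : ℕ) : K) = -2 := by
    rw [Nat.cast_sub (by omega), hqK]; simp
  have hq' : q - 2 - 1 = q - 3 := by omega
  have h3 (k : Fin 3) : pderiv k (3 : MvPolynomial (Fin 3) K) = 0 := by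
    rw [← map_ofNat C 3]; exact pderiv_C
  rw [pderiv_specialForm (by omega) hqK]
  fin_cases i <;> fin_cases j <;>
    simp [Derivation.leibniz, pderiv_X, hc, hq', h3] <;> ring

/-- The common zeros of the partial derivatives of the special form are the multiples of `(1, 1, 1)`.
The exponent `p ^ n` may be any power, at least `3`, of the exponential characteristic. -/
theorem eq_of_pow_eq_three_mul_pow {K : Type*} [Field K] {p n : ℕ} [ExpChar K p]
    (hq : 3 ≤ p ^ n) (h2 : (2 : K) ≠ 0) (h3 : (3 : K) ≠ 0) {v : Fin 3 → K} (hv : v ≠ 0)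
    (h : ∀ i, 3 * (v 0 + v 1 + v 2) ^ (p ^ n - 2) - v i ^ (p ^ n - 2) = 0) :
    v 0 = v 2 ∧ v 1 = v 2 := by
  set x := v 0
  set y := v 1
  set z := v 2
  set q := p ^ n with hqdef
  set s := x + y + z with hs
  have hs0 : s ≠ 0 := by
    intro hs0
    refine hv (funext fun i => ?_)
    have := h i
    rw [hs0, zero_pow (by omega), mul_zero, zero_sub, neg_eq_zero] at this
    exact eq_zero_of_pow_eq_zero this
  set c := 3 * s ^ (q - 2) with hc
  have hc0 : c ≠ 0 := mul_ne_zero h3 (pow_ne_zero _ hs0)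
  -- Frobenius acts on the coordinates, and on their sum, as `c` times squaring.
  have hpow (i : Fin 3) : v i ^ q = c * v i ^ 2 := by
    rw [sub_eq_zero.mp (h i), ← pow_add, Nat.sub_add_cancel (by omega)]
  have hx : x ^ q = c * x ^ 2 := hpow 0
  have hy : y ^ q = c * y ^ 2 := hpow 1
  have hz : z ^ q = c * z ^ 2 := hpow 2
  have hsq : 3 * s ^ q = c * s ^ 2 := by
    rw [hc, mul_assoc, ← pow_add, Nat.sub_add_cancel (by omega)]
  have hsum : s ^ q = x ^ q + y ^ q + z ^ q := by
    rw [hs, hqdef, add_pow_expChar_pow, add_pow_expChar_pow]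
  have hquad : 3 * (x ^ 2 + y ^ 2 + z ^ 2) = s ^ 2 := by
    apply mul_left_cancel₀ hc0
    rw [← hsq, hsum, hx, hy, hz]; ring
  have hab : (x - z) ^ 2 - (x - z) * (y - z) + (y - z) ^ 2 = 0 := by
    apply mul_left_cancel₀ h2
    rw [hs] at hquad
    linear_combination hquad
  have ha : (x - z) ^ q = c * ((x - z) * (x + z)) := by
    rw [hqdef, sub_pow_expChar_pow, ← hqdef, hx, hz]; ring
  have hb : (y - z) ^ q = c * ((y - z) * (y + z)) := by
    rw [hqdef, sub_pow_expChar_pow, ← hqdef, hy, hz]; ring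
  -- Frobenius applied to `hab`.
  have hfrob : ((x - z) * (x + z)) ^ 2 - ((x - z) * (x + z)) * ((y - z) * (y + z)) +
      ((y - z) * (y + z)) ^ 2 = 0 := by
    have h0 := congrArg (· ^ q) hab
    simp only [zero_pow (show q ≠ 0 by omega)] at h0
    rw [hqdef, add_pow_expChar_pow, sub_pow_expChar_pow, ← hqdef, mul_pow, ← pow_mul, ← pow_mul,
      mul_comm 2 q, pow_mul, pow_mul, ha, hb] at h0
    apply mul_left_cancel₀ (pow_ne_zero 2 hc0)
    linear_combination h0
  by_cases hb0 : y - z = 0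
  · have ha0 : x - z = 0 := by simpa [hb0] using hab
    exact ⟨sub_eq_zero.mp ha0, sub_eq_zero.mp hb0⟩
  exfalso
  have hxy : x - y ≠ 0 := by
    intro h'
    rw [sub_eq_zero.mp h'] at hab
    exact hb0 (eq_zero_of_pow_eq_zero (n := 2) (by linear_combination hab))
  -- With `a = x - z` and `b = y - z`, eliminating `a ^ 2` between `hfrob` and `hab` leaves the factor
  -- `2 * b * (a - b)` times this relation.
  have hz' : (y - z) ^ 2 = z * (x - z - 2 * (y - z)) := by
    apply mul_left_cancel₀ (mul_ne_zero h2 (mul_ne_zero hb0 hxy))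
    linear_combination -hfrob + ((x + z) ^ 2 + (y - z) * (x - y)) * hab
  -- As `s = a + b + 3 * z`, this relation and `hab` combine to `s * (a - 2 * b) = 0`.
  have hsz : s * (x - z - 2 * (y - z)) = 0 := by
    rw [hs]
    linear_combination hab - 3 * hz'
  have hxz : x - z = 2 * (y - z) := sub_eq_zero.mp ((mul_eq_zero.mp hsz).resolve_left hs0)
  rw [hxz] at hab
  exact hb0 (eq_zero_of_pow_eq_zero (n := 2) (mul_left_cancel₀ h3 (by linear_combination hab)))

end PlaneCurve

/-! ### Points whose tangent line passes through a given point -/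

namespace PlaneCurve

section TangentFilling

variable {F : Type*} [Field F]

/-- The point `[a:b:c]` is on the tangent line to the curve at some smooth rational point `[x:y:z]`,
with denominators cleared in `(a/x + b/y + c/z) (x + y + z) = 3 (a + b + c)`. -/
def HasTangentThrough (a b c : F) : Prop :=
  ∃ x y z : F, x ≠ 0 ∧ y ≠ 0 ∧ z ≠ 0 ∧ x + y + z ≠ 0 ∧ ¬(x = z ∧ y = z) ∧
    (a * (y * z) + b * (x * z) + c * (x * y)) * (x + y + z) = 3 * (a + b + c) * (x * y * z)

theorem HasTangentThrough.swap {a b c : F} (h : HasTangentThrough a b c) :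
    HasTangentThrough b a c := by
  obtain ⟨x, y, z, hx, hy, hz, hs, hne, h⟩ := h
  exact ⟨y, x, z, hy, hx, hz, by rwa [add_comm y x], fun h => hne h.symm,
    by linear_combination h⟩

theorem HasTangentThrough.rotate {a b c : F} (h : HasTangentThrough a b c) :
    HasTangentThrough b c a := by
  obtain ⟨x, y, z, hx, hy, hz, hs, hne, h⟩ := h
  exact ⟨y, z, x, hy, hz, hx, fun h => hs (by linear_combination h),
    fun h => hne ⟨h.2.symm, h.1.trans h.2.symm⟩, by linear_combination h⟩

/-- For `[a:b:c]` in general position, the line joining `[1:1:1]` to `[1:0:0]` contains a solution. -/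
theorem hasTangentThrough_of_generic (h2 : (2 : F) ≠ 0) {a b c : F} (ha : a ≠ 0)
    (hbc : b + c ≠ 0) (hne : 2 * a ≠ b + c) (hs : a + b + c ≠ 0) : HasTangentThrough a b c := by
  refine ⟨2 * a, b + c, b + c, mul_ne_zero h2 ha, hbc, hbc, fun h => ?_, fun h => hne h.1,
    by ring⟩
  exact mul_ne_zero h2 hs (by linear_combination h)

/-- For a vertex of the coordinate triangle, the equation becomes that of the line `y + z = 2 x`. -/
theorem hasTangentThrough_vertex (h2 : (2 : F) ≠ 0) (h3 : (3 : F) ≠ 0) (a : F) :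
    HasTangentThrough a 0 0 := by
  refine ⟨1, 3, -1, one_ne_zero, h3, by simp, fun h => h3 (by linear_combination h),
    fun h => h2 (by linear_combination h.1), by ring⟩

theorem _root_.Polynomial.exists_eval_ne_zero_of_natDegree_lt_fintype_card [Fintype F]
    {f : Polynomial F} (hf : f ≠ 0) (hdeg : f.natDegree < Fintype.card F) : ∃ r, f.eval r ≠ 0 :=
  f.exists_eval_ne_zero_of_natDegree_lt_card hf
    (by rw [Cardinal.mk_fintype]; exact Nat.cast_lt.mpr hdeg)

/-- For `[1:1:1]` the solutions form a cubic with a node at `[1:1:1]`, which the slope `m` of the lines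
through the node parametrises. At most seven values of `m` are excluded. -/
theorem hasTangentThrough_diagonal [Fintype F] (hq : 8 ≤ Fintype.card F) (h2 : (2 : F) ≠ 0)
    (a : F) : HasTangentThrough a a a := by
  obtain ⟨m, hm⟩ : ∃ m : F, m * (m - 1) * (m + 1) * (m - 2) * (2 * m - 1) * (m ^ 2 - m + 1) ≠ 0 := by
    have h1 : (Polynomial.X - 1 : Polynomial F) ≠ 0 := by
      simpa using Polynomial.X_sub_C_ne_zero (1 : F)
    have h1' : (Polynomial.X + 1 : Polynomial F) ≠ 0 := by
      simpa using Polynomial.X_add_C_ne_zero (1 : F)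
    have h4 : (Polynomial.C 2 * Polynomial.X - 1 : Polynomial F) ≠ 0 := fun h => by
      simpa using congrArg (Polynomial.eval 0) h
    have h5 : (Polynomial.X ^ 2 - Polynomial.X + 1 : Polynomial F) ≠ 0 := fun h => by
      simpa using congrArg (Polynomial.eval 0) h
    obtain ⟨m, hm⟩ := Polynomial.exists_eval_ne_zero_of_natDegree_lt_fintype_card
      (mul_ne_zero (mul_ne_zero (mul_ne_zero (mul_ne_zero (mul_ne_zero
        (Polynomial.X_ne_zero (R := F)) h1) h1') (Polynomial.X_sub_C_ne_zero 2)) h4) h5)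
      (lt_of_le_of_lt (b := 7) (by compute_degree) (by omega))
    exact ⟨m, by simpa using hm⟩
  simp only [mul_ne_zero_iff] at hm
  obtain ⟨⟨⟨⟨⟨m0, m1⟩, m2⟩, m3⟩, m4⟩, m5⟩ := hm
  refine ⟨-((m - 1) * (m - 2)), -(m * (2 * m - 1) * (m - 1)), m * (m + 1),
    neg_ne_zero.mpr (mul_ne_zero m1 m3), neg_ne_zero.mpr (mul_ne_zero (mul_ne_zero m0 m4) m1),
    mul_ne_zero m0 m2, fun h => ?_, fun h => ?_, by ring⟩
  · exact mul_ne_zero (mul_ne_zero m2 m4) m3 (by linear_combination -h)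
  · exact mul_ne_zero h2 m5 (by linear_combination -h.1)

/-- For `a + b + c = 0` the solutions satisfy `a/x + b/y + c/z = 0`, which is a line in the coordinates
`[1/x : 1/y : 1/z]`; the parameter is `t = x / y`. -/
theorem hasTangentThrough_of_add_eq_zero [Fintype F] (hq : 6 ≤ Fintype.card F)
    {a b c : F} (hc : c ≠ 0) (hs : a + b + c = 0) : HasTangentThrough a b c := by
  obtain rfl : c = -(a + b) := by linear_combination hs
  have hab : a + b ≠ 0 := neg_ne_zero.mp hc
  obtain ⟨t, ht⟩ : ∃ t : F, t * (t - 1) * (b * t + a) * (b * t ^ 2 + 2 * (a + b) * t + a) ≠ 0 := by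
    have h1 : (Polynomial.X - 1 : Polynomial F) ≠ 0 := by
      simpa using Polynomial.X_sub_C_ne_zero (1 : F)
    have h2 : (Polynomial.C b * Polynomial.X + Polynomial.C a : Polynomial F) ≠ 0 := fun h => by
      have := congrArg (Polynomial.eval 1) h
      simp only [Polynomial.eval_add, Polynomial.eval_mul, Polynomial.eval_C, Polynomial.eval_X,
        Polynomial.eval_zero] at this
      exact hab (by linear_combination this)
    have h3 : (Polynomial.C b * Polynomial.X ^ 2 + Polynomial.C (2 * (a + b)) * Polynomial.X +
        Polynomial.C a : Polynomial F) ≠ 0 := fun h => by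
      have e0 := congrArg (Polynomial.coeff · 0) h
      have e2 := congrArg (Polynomial.coeff · 2) h
      simp [Polynomial.coeff_X, Polynomial.coeff_C] at e0 e2
      exact hab (by rw [e0, e2, add_zero])
    obtain ⟨t, ht⟩ := Polynomial.exists_eval_ne_zero_of_natDegree_lt_fintype_card
      (mul_ne_zero (mul_ne_zero (mul_ne_zero (Polynomial.X_ne_zero (R := F)) h1) h2) h3)
      (lt_of_le_of_lt (b := 5) (by compute_degree) (by omega))
    exact ⟨t, by simpa using ht⟩
  simp only [mul_ne_zero_iff] at ht
  obtain ⟨⟨⟨t0, t1⟩, t2⟩, t3⟩ := ht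
  refine ⟨t * (b * t + a), b * t + a, (a + b) * t, mul_ne_zero t0 t2, t2, mul_ne_zero hab t0,
    fun h => t3 (by linear_combination h), fun h => ?_, by ring⟩
  exact mul_ne_zero t1 t2 (by linear_combination h.1 - h.2)

theorem hasTangentThrough_of_ne_zero [Fintype F] (hq : 8 ≤ Fintype.card F) (h2 : (2 : F) ≠ 0)
    (h3 : (3 : F) ≠ 0) {a b c : F} (h : ¬(a = 0 ∧ b = 0 ∧ c = 0)) : HasTangentThrough a b c := by
  by_cases hs : a + b + c = 0
  · by_cases hc : c = 0
    · by_cases hb : b = 0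
      · have ha : a ≠ 0 := fun ha => h ⟨ha, hb, hc⟩
        exact absurd (by simpa [hb, hc] using hs) ha
      · refine (hasTangentThrough_of_add_eq_zero (by omega) hb ?_).rotate
        linear_combination hs
    · exact hasTangentThrough_of_add_eq_zero (by omega) hc hs
  by_cases ha : a = 0 ∨ b + c = 0 ∨ 2 * a = b + c
  swap
  · push Not at ha
    exact hasTangentThrough_of_generic h2 ha.1 ha.2.1 ha.2.2 hs
  by_cases hb : b = 0 ∨ c + a = 0 ∨ 2 * b = c + a
  swap
  · push Not at hb
    exact (hasTangentThrough_of_generic h2 hb.1 hb.2.1 hb.2.2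
      (fun h => hs (by linear_combination h))).rotate.rotate
  by_cases hc : c = 0 ∨ a + b = 0 ∨ 2 * c = a + b
  swap
  · push Not at hc
    exact (hasTangentThrough_of_generic h2 hc.1 hc.2.1 hc.2.2
      (fun h => hs (by linear_combination h))).rotate
  -- Now each coordinate is `0`, the sum of all three, or a third of the sum.
  have key : (b = 0 ∧ c = 0) ∨ (c = 0 ∧ a = 0) ∨ (a = 0 ∧ b = 0) ∨ (a = c ∧ b = c) := by
    have h4 : (4 : F) ≠ 0 := fun h => h2 (eq_zero_of_pow_eq_zero (n := 2) (by linear_combination h))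
    have h6 : (6 : F) ≠ 0 := fun h => mul_ne_zero h2 h3 (by linear_combination h)
    grind
  rcases key with ⟨rfl, rfl⟩ | ⟨rfl, rfl⟩ | ⟨rfl, rfl⟩ | ⟨rfl, rfl⟩
  · exact hasTangentThrough_vertex h2 h3 a
  · exact (hasTangentThrough_vertex h2 h3 b).rotate.rotate
  · exact (hasTangentThrough_vertex h2 h3 c).rotate
  · exact hasTangentThrough_diagonal hq h2 _

end TangentFilling

end PlaneCurve

/-! ### The curve over a finite field and its algebraic closure -/

namespace PlaneCurve

section FiniteField

variable (F : Type*) [Field F] [Fintype F]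

theorem isTangentFilling_specialForm (hq : 8 ≤ Fintype.card F) (h2 : (2 : F) ≠ 0)
    (h3 : (3 : F) ≠ 0) : IsTangentFilling (specialForm F (Fintype.card F)) := by
  set q := Fintype.card F with hqdef
  have hqF : (q : F) = 0 := FiniteField.cast_card_eq_zero F
  have pow1 {a : F} (ha : a ≠ 0) : a ^ (q - 1) = 1 := FiniteField.pow_card_sub_one_eq_one a ha
  have pow2 {a : F} (ha : a ≠ 0) : a ^ (q - 2) = a⁻¹ := by
    refine eq_inv_of_mul_eq_one_left ?_
    rw [← pow_succ, show q - 2 + 1 = q - 1 by omega, pow1 ha]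
  intro P
  induction P using Projectivization.ind with | h u hu =>
  have hu' : ¬(u 0 = 0 ∧ u 1 = 0 ∧ u 2 = 0) := fun h =>
    hu (by ext i; fin_cases i; exacts [h.1, h.2.1, h.2.2])
  obtain ⟨x, y, z, hx, hy, hz, hs, hne, h⟩ :=
    hasTangentThrough_of_ne_zero (by omega : 8 ≤ Fintype.card F) h2 h3 hu'
  have hG := isHomogeneous_specialForm F q
  have hv : ![x, y, z] ≠ 0 := fun h => hx (by simpa using congrFun h 0)
  refine ⟨Projectivization.mk F ![x, y, z] hv, (isSmoothAt_mk hG _ hv).mpr ⟨?_, ?_⟩,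
    (mk_mem_tangentLine_mk hG u _ hu hv).mpr ?_⟩
  · rw [eval_specialForm]
    simp only [Matrix.cons_val, pow1 hx, pow1 hy, pow1 hz, pow1 hs]
    ring
  · by_contra! hsing
    have e0 := hsing 0
    have e1 := hsing 1
    have e2 := hsing 2
    simp only [eval_pderiv_specialForm (by omega : 2 ≤ q) hqF, Matrix.cons_val, pow2 hx, pow2 hy,
      pow2 hz] at e0 e1 e2
    exact hne ⟨inv_injective (by linear_combination e2 - e0),
      inv_injective (by linear_combination e2 - e1)⟩
  · simp only [Fin.sum_univ_three, eval_pderiv_specialForm (by omega : 2 ≤ q) hqF,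
      Matrix.cons_val, pow2 hx, pow2 hy, pow2 hz, pow2 hs]
    field_simp
    linear_combination -h

variable {F}

/-- Over any extension `K` of the finite field, the singular points are the multiples of `(1, 1, 1)`. -/
theorem specialForm_singular_iff {K : Type*} [Field K] [Algebra F K]
    (hq : 3 ≤ Fintype.card F) (h2 : (2 : F) ≠ 0) (h3 : (3 : F) ≠ 0) {v : Fin 3 → K} (hv : v ≠ 0) :
    (eval v (specialForm K (Fintype.card F)) = 0 ∧
      ∀ i, eval v (pderiv i (specialForm K (Fintype.card F))) = 0) ↔ v 0 = v 2 ∧ v 1 = v 2 := by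
  obtain ⟨n, hp, hn⟩ := FiniteField.card F (ringChar F)
  have : Fact (ringChar F).Prime := ⟨hp⟩
  have : CharP K (ringChar F) := charP_of_injective_algebraMap (algebraMap F K).injective _
  have : ExpChar K (ringChar F) := ExpChar.prime hp
  have h2K : (2 : K) ≠ 0 := by
    rw [← map_ofNat (algebraMap F K) 2]; exact (map_ne_zero _).mpr h2
  have h3K : (3 : K) ≠ 0 := by
    rw [← map_ofNat (algebraMap F K) 3]; exact (map_ne_zero _).mpr h3
  have hqK : ((Fintype.card F : ℕ) : K) = 0 := by
    rw [← map_natCast (algebraMap F K), FiniteField.cast_card_eq_zero, map_zero]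
  have hpow : (3 : K) ^ (Fintype.card F - 1) = 1 := by
    rw [← map_ofNat (algebraMap F K) 3, ← map_pow, FiniteField.pow_card_sub_one_eq_one _ h3, map_one]
  simp only [eval_pderiv_specialForm (by omega : 2 ≤ Fintype.card F) hqK, eval_specialForm]
  constructor
  · rintro ⟨-, h⟩
    rw [hn] at h hq
    exact eq_of_pow_eq_three_mul_pow hq h2K h3K hv h
  · rintro ⟨h0, h1⟩
    have hs : v 0 + v 1 + v 2 = 3 * v 2 := by rw [h0, h1]; ring
    have hpow' : 3 * (3 : K) ^ (Fintype.card F - 2) = 1 := by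
      rw [← pow_succ', show Fintype.card F - 2 + 1 = Fintype.card F - 1 by omega, hpow]
    rw [hs, h0, h1]
    refine ⟨?_, fun i => ?_⟩
    · rw [mul_pow, hpow]; ring
    · have hi : v i = v 2 := by fin_cases i; exacts [h0, h1, rfl]
      rw [hi, mul_pow]
      linear_combination v 2 ^ (Fintype.card F - 2) * hpow'

theorem singularLocus_specialForm (hq : 3 ≤ Fintype.card F) (h2 : (2 : F) ≠ 0)
    (h3 : (3 : F) ≠ 0) : singularLocus (specialForm F (Fintype.card F)) =
      {pointOne (AlgebraicClosure F)} := by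
  ext P
  induction P using Projectivization.ind with | h v hv =>
  rw [singularLocus, Set.mem_ofPred_eq, geometric_specialForm,
    isSingularAt_mk (isHomogeneous_specialForm _ _), specialForm_singular_iff hq h2 h3 hv,
    Set.mem_singleton_iff, pointOne, Projectivization.mk_eq_mk_iff']
  constructor
  · rintro ⟨h0, h1⟩
    exact ⟨v 2, by ext i; fin_cases i <;> simp [h0, h1]⟩
  · rintro ⟨a, rfl⟩
    simp

theorem irreducible_specialForm {K : Type*} [Field K] [IsAlgClosed K] [Algebra F K]
    (hq : 4 ≤ Fintype.card F) (h2 : (2 : F) ≠ 0) (h3 : (3 : F) ≠ 0) :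
    Irreducible (specialForm K (Fintype.card F)) := by
  have h2K : (2 : K) ≠ 0 := by
    rw [← map_ofNat (algebraMap F K) 2]; exact (map_ne_zero _).mpr h2
  have hqK : ((Fintype.card F : ℕ) : K) = 0 := by
    rw [← map_natCast (algebraMap F K), FiniteField.cast_card_eq_zero, map_zero]
  have hpow : (3 : K) ^ (Fintype.card F - 1) = 1 := by
    rw [← map_ofNat (algebraMap F K) 3, ← map_pow, FiniteField.pow_card_sub_one_eq_one _ h3, map_one]
  have hpow' : 9 * (3 : K) ^ (Fintype.card F - 3) = 1 := by
    rw [← hpow, show Fintype.card F - 1 = Fintype.card F - 3 + 2 by omega, pow_add]; ring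
  refine irreducible_of_node_at_one (isHomogeneous_specialForm K _) (by omega)
    (specialForm_ne_zero (by omega) h2K)
    (fun v hv h h' => (specialForm_singular_iff (by omega) h2 h3 hv).mp ⟨h, h'⟩) fun w hw => ?_
  have e0 := hw 0
  have e1 := hw 1
  have e2 := hw 2
  have h111 : (1 + 1 + 1 : K) = 3 := by norm_num
  simp [eval_pderiv_pderiv_specialForm (by omega : 3 ≤ Fintype.card F) hqK, h111] at e0 e1 e2
  ext i
  fin_cases i
  · exact mul_left_cancel₀ h2K (show 2 * w 0 = 2 * 0 by linear_combination e0 - e2)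
  · exact mul_left_cancel₀ h2K (show 2 * w 1 = 2 * 0 by linear_combination e1 - e2)

end FiniteField

end PlaneCurve

theorem theorem1p3 (F : Type*) [Field F] [Fintype F]
    (hq : 11 ≤ Fintype.card F) (hp : 3 < ringChar F) :
    (PlaneCurve.specialForm F (Fintype.card F)).IsHomogeneous (Fintype.card F - 1) ∧
    (PlaneCurve.specialForm F (Fintype.card F)).totalDegree = Fintype.card F - 1 ∧
    PlaneCurve.IsGeometricallyIrreducible (PlaneCurve.specialForm F (Fintype.card F)) ∧
    PlaneCurve.IsTangentFilling (PlaneCurve.specialForm F (Fintype.card F)) ∧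
    PlaneCurve.singularLocus (PlaneCurve.specialForm F (Fintype.card F)) =
      {PlaneCurve.pointOne (AlgebraicClosure F)} := by
  have cast_ne {k : ℕ} (hk : 0 < k) (hk' : k < ringChar F) : (k : F) ≠ 0 := fun h =>
    absurd (Nat.le_of_dvd hk (ringChar.dvd h)) (by omega)
  have h2 : (2 : F) ≠ 0 := by exact_mod_cast cast_ne (k := 2) (by omega) (by omega)
  have h3 : (3 : F) ≠ 0 := by exact_mod_cast cast_ne (k := 3) (by omega) hp
  have hG := PlaneCurve.isHomogeneous_specialForm F (Fintype.card F)
  refine ⟨hG, hG.totalDegree (PlaneCurve.specialForm_ne_zero (by omega) h2), ?_,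
    PlaneCurve.isTangentFilling_specialForm F (by omega) h2 h3,
    PlaneCurve.singularLocus_specialForm (by omega) h2 h3⟩
  rw [PlaneCurve.IsGeometricallyIrreducible, PlaneCurve.geometric_specialForm]
  exact PlaneCurve.irreducible_specialForm (by omega) h2 h3
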